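/- Let $d\ge 1$ and $N\ge 1$ be integers. A sub-probability is a nonnegative Borel measure $\rho$ on $\mathbb{R}^d$ with mass $\|\rho\|=\rho(\mathbb{R}^d)\le 1$; let $\mathcal{P}^-$ be the set of sub-probabilities and $\mathcal{P}$ the set of Borel probabilities on $\mathbb{R}^d$. For $k\ge 1$ let $$c_k(x_1,\dots,x_k)=\sum_{1\le i<j\le k}\frac{1}{|x_i-x_j|}\in[0,+\infty],\qquad x_1,\dots,x_k\in\mathbb{R}^d,$$ with the convention $1/0=+\infty$, and for $\mu\in\mathcal{P}^-$ let $$\mathcal{C}_k(\mu)=\inf\left\{\int_{(\mathbb{R}^d)^k}c_k\,dP\right\},$$ where $P$ runs over the nonnegative Borel measures on $(\mathbb{R}^d)^k$ with total mass $\|P\|=\|\mu\|$ all of whose $k$ marginals on $\mathbb{R}^d$ are equal to $\mu$ (so $\mathcal{C}_1\equiv 0$). For $\rho\in\mathcal{P}$ let $$C(\rho)=\inf\left\{\int_{(\mathbb{R}^d)^N}c_N\,dP\ :\ P\text{ a Borel probability on }(\mathbb{R}^d)^N\text{ with all $N$ marginals equal to }\rho\right\},$$ and for $\rho\in\mathcal{P}^-$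 let $$\overline{C}(\rho)=\inf\left\{\liminf_{n\to\infty} C(\rho_n)\ :\ \rho_n\in\mathcal{P},\ \rho_n\stackrel{*}{\rightharpoonup}\rho\right\}\in[0,+\infty],$$ where $\rho_n\stackrel{*}{\rightharpoonup}\rho$ means $\int\varphi\,d\rho_n\to\int\varphi\,d\rho$ for every continuous $\varphi:\mathbb{R}^d\to\mathbb{R}$ vanishing at infinity. Theorem (stratification formula). For every $\rho\in\mathcal{P}^-$, $$\overline{C}(\rho)=\inf\left\{\sum_{k=1}^N\mathcal{C}_k(\rho_k)\ :\ \rho_k\in\mathcal{P}^-,\ \sum_{k=1}^N\frac{k}{N}\rho_k=\rho,\ \sum_{k=1}^N\|\rho_k\|\le 1\right\}.$$ Moreover, the infimum on the right-hand side is attained whenever $\overline{C}(\rho)<+\infty$. -/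

import Mathlib

open MeasureTheory Filter Topology
open scoped ENNReal ZeroAtInfty

/-- The Coulomb cost `∑_{i<j} 1 / |x_i - x_j|` of `k` points of `ℝ^d`, with values in `[0, ∞]`
(two coinciding points have cost `∞`). -/
noncomputable def coulombCost {d : ℕ} (k : ℕ) (x : Fin k → EuclideanSpace ℝ (Fin d)) : ℝ≥0∞ :=
  ∑ i : Fin k, ∑ j ∈ Finset.Ioi i, ‖x i - x j‖ₑ⁻¹

/-- The multi-marginal transport plans `Π(ρ)`: Borel probabilities on `(ℝ^d)^N` all of whose
`N` marginals are `ρ`. -/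
def transportPlans {d : ℕ} (N : ℕ) (ρ : Measure (EuclideanSpace ℝ (Fin d))) :
    Set (Measure (Fin N → EuclideanSpace ℝ (Fin d))) :=
  {P | IsProbabilityMeasure P ∧ ∀ i : Fin N, P.map (fun x => x i) = ρ}

/-- The multi-marginal Coulomb transport cost `C(ρ)` with `N` marginals. -/
noncomputable def transportCost {d : ℕ} (N : ℕ)
    (ρ : Measure (EuclideanSpace ℝ (Fin d))) : ℝ≥0∞ :=
  ⨅ P ∈ transportPlans N ρ, ∫⁻ x, coulombCost N x ∂P

/-- Weak* convergence of a sequence of measures on `ℝ^d`, in duality with the continuous functions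
vanishing at infinity. It is only used for finite measures, against which these functions are
integrable. -/
def WeakStarTendsto {d : ℕ} (ρs : ℕ → Measure (EuclideanSpace ℝ (Fin d)))
    (ρ : Measure (EuclideanSpace ℝ (Fin d))) : Prop :=
  ∀ φ : C₀(EuclideanSpace ℝ (Fin d), ℝ),
    Tendsto (fun n => ∫ x, φ x ∂(ρs n)) atTop (𝓝 (∫ x, φ x ∂ρ))

/-- The relaxed cost `C̄(ρ)`: the infimum of `liminf_n C(ρ_n)` over all sequences of probabilities
`ρ_n` that converge weakly* to `ρ`. -/
noncomputable def relaxedCost {d : ℕ} (N : ℕ)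
    (ρ : Measure (EuclideanSpace ℝ (Fin d))) : ℝ≥0∞ :=
  ⨅ (ρs : ℕ → Measure (EuclideanSpace ℝ (Fin d)))
    (_ : (∀ n, IsProbabilityMeasure (ρs n)) ∧ WeakStarTendsto ρs ρ),
    liminf (fun n => transportCost N (ρs n)) atTop

/-- The plans for the partial costs: nonnegative Borel measures on `(ℝ^d)^k` with the same total
mass as `μ`, all of whose `k` marginals are `μ`. -/
def partialPlans {d : ℕ} (k : ℕ) (μ : Measure (EuclideanSpace ℝ (Fin d))) :
    Set (Measure (Fin k → EuclideanSpace ℝ (Fin d))) :=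
  {P | P Set.univ = μ Set.univ ∧ ∀ i : Fin k, P.map (fun x => x i) = μ}

/-- The partial `k`-marginal Coulomb cost `𝒞_k(μ)` of a sub-probability `μ`. -/
noncomputable def partialCost {d : ℕ} (k : ℕ)
    (μ : Measure (EuclideanSpace ℝ (Fin d))) : ℝ≥0∞ :=
  ⨅ P ∈ partialPlans k μ, ∫⁻ x, coulombCost k x ∂P

/-- For `k = 1` there is no interaction: `𝒞_1 = 0`. -/
theorem partialCost_one {d : ℕ} (μ : Measure (EuclideanSpace ℝ (Fin d))) :
    partialCost 1 μ = 0 := by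
  have hm : Measurable (fun (y : EuclideanSpace ℝ (Fin d)) (_ : Fin 1) => y) := by fun_prop
  refine le_antisymm ?_ bot_le
  have hP : μ.map (fun y (_ : Fin 1) => y) ∈ partialPlans 1 μ := by
    refine ⟨?_, fun i => ?_⟩
    · rw [Measure.map_apply hm MeasurableSet.univ, Set.preimage_univ]
    · rw [Measure.map_map (measurable_pi_apply i) hm]
      exact Measure.map_id
  refine (iInf₂_le _ hP).trans ?_
  simp [coulombCost]

/-- The admissible families `(ρ_1, …, ρ_N)` of the stratification formula for `ρ`: sub-probabilities
with `∑ (k/N) ρ_k = ρ` and `∑ ‖ρ_k‖ ≤ 1`. Only the values of `ν` at `1, …, N` matter. -/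
def stratifications {d : ℕ} (N : ℕ) (ρ : Measure (EuclideanSpace ℝ (Fin d))) :
    Set (ℕ → Measure (EuclideanSpace ℝ (Fin d))) :=
  {ν | (∀ k ∈ Finset.Icc 1 N, ν k Set.univ ≤ 1) ∧
    ∑ k ∈ Finset.Icc 1 N, ((k : ℝ≥0∞) / (N : ℝ≥0∞)) • ν k = ρ ∧
    ∑ k ∈ Finset.Icc 1 N, ν k Set.univ ≤ 1}

/-! Mass lost in a weak* limit is mass sent to infinity, where points stop interacting. The formula
sorts `N`-point configurations by the number `k` of points that stay in `ℝ^d`; such a configuration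
puts `k` of its `N` points into the limit, whence the weight `k/N`.

For `≤`, near-optimal plans for the `ρ_k` are completed by `N - k` points far along a half-line, at
distance at least `n` from each other and from the rest. The missing mass `1 - ∑ ‖ρ_k‖` goes to
configurations with no original point. The extra cost is at most `N² / n`, the added points vanish
weakly*, and a cyclic symmetrization makes all marginals equal (`relaxedCost_le_sum_lintegral`).

For `≥`, plans are pushed to the compact space of `N`-tuples in `ℝ^d ∪ {∞}`, with the kernel
extended by `0` at infinity. This kernel is lower semicontinuous, so a recovery sequence has a limit
plan of no larger cost (`exists_extPlan_of_liminf_lt`). Cutting that plan according to the set of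
finite points gives an admissible stratification that is no more expensive
(`stratumMarginal_mem_stratifications`, `sum_partialCost_stratumMarginal_le`). Applied to a
minimizer over the compact set `extPlans`, this also yields attainment. -/

/-! ### Pair sums of symmetric kernels. -/

section PairSums

/-- A sum over ordered pairs `i < j` as a sum over a set of pairs. -/
theorem sum_Ioi_eq_sum_pairs {M : Type*} [AddCommMonoid M] {k : ℕ} (h : Fin k → Fin k → M) :
    ∑ i, ∑ j ∈ Finset.Ioi i, h i j =
      ∑ p ∈ (Finset.univ : Finset (Fin k × Fin k)).filter (fun p => p.1 < p.2), h p.1 p.2 := by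
  rw [Finset.sum_filter, Fintype.sum_prod_type]
  refine Finset.sum_congr rfl fun i _ => ?_
  rw [← Finset.sum_filter]
  refine Finset.sum_congr ?_ fun _ _ => rfl
  ext j
  simp

/-- For a symmetric kernel, the sum over `i < j` is half the sum over `i ≠ j`. -/
theorem two_mul_sum_Ioi {k : ℕ} (h : Fin k → Fin k → ℝ≥0∞) (hs : ∀ a b, h a b = h b a) :
    2 * ∑ i, ∑ j ∈ Finset.Ioi i, h i j =
      ∑ p ∈ (Finset.univ : Finset (Fin k)).offDiag, h p.1 p.2 := by
  have hsplit : (Finset.univ : Finset (Fin k)).offDiag =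
      (Finset.univ : Finset (Fin k × Fin k)).filter (fun p => p.1 < p.2) ∪
      (Finset.univ : Finset (Fin k × Fin k)).filter (fun p => p.2 < p.1) := by
    ext p
    simp
  have hdisj : Disjoint
      ((Finset.univ : Finset (Fin k × Fin k)).filter (fun p => p.1 < p.2))
      ((Finset.univ : Finset (Fin k × Fin k)).filter (fun p => p.2 < p.1)) := by
    rw [Finset.disjoint_filter]
    exact fun p _ h1 h2 => lt_asymm h1 h2
  rw [hsplit, Finset.sum_union hdisj, two_mul, sum_Ioi_eq_sum_pairs]
  congr 1
  refine Finset.sum_nbij' Prod.swap Prod.swap ?_ ?_ ?_ ?_ ?_ <;> simp [hs]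

/-- Selecting indices injectively does not increase the pair sum of a symmetric kernel. -/
theorem sum_Ioi_comp_embedding_le {k N : ℕ} (h : Fin N → Fin N → ℝ≥0∞)
    (hs : ∀ a b, h a b = h b a) (f : Fin k ↪ Fin N) :
    ∑ i, ∑ j ∈ Finset.Ioi i, h (f i) (f j) ≤ ∑ i, ∑ j ∈ Finset.Ioi i, h i j := by
  -- `f` need not be increasing, so it may reverse pairs; doubling replaces `i < j` by `i ≠ j`, a
  -- condition that injections preserve.
  have h2 : 2 * ∑ i, ∑ j ∈ Finset.Ioi i, h (f i) (f j) ≤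
      2 * ∑ i, ∑ j ∈ Finset.Ioi i, h i j := by
    rw [two_mul_sum_Ioi _ hs, two_mul_sum_Ioi _ (fun a b => hs (f a) (f b))]
    refine (Finset.sum_map (Finset.univ.offDiag) (f.prodMap f)
      (fun p => h p.1 p.2)).symm.trans_le ?_
    refine Finset.sum_le_sum_of_subset fun p hp => ?_
    simp only [Finset.mem_map, Finset.mem_offDiag, Finset.mem_univ, true_and] at hp ⊢
    obtain ⟨q, hq, rfl⟩ := hp
    simpa using hq
  exact (ENNReal.mul_le_mul_iff_right (by norm_num) (by norm_num)).1 h2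

end PairSums

/-! ### Lower semicontinuity of integrals under weak convergence. -/

section LowerSemicontinuity

variable {Y : Type*} [TopologicalSpace Y] [MeasurableSpace Y]

/-- Layer-cake formula: the superlevel sets of `f` are open, so the hypothesis applies at each
level, and Fatou's lemma integrates over the levels. -/
theorem lintegral_ofReal_le_liminf_of_lowerSemicontinuous [OpensMeasurableSpace Y]
    {μ : Measure Y} {μs : ℕ → Measure Y}
    {f : Y → ℝ} (hf : LowerSemicontinuous f) (f_nn : 0 ≤ f)
    (h_opens : ∀ G, IsOpen G → μ G ≤ atTop.liminf (fun i => μs i G)) :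
    ∫⁻ x, ENNReal.ofReal (f x) ∂μ ≤ atTop.liminf (fun i => ∫⁻ x, ENNReal.ofReal (f x) ∂(μs i)) := by
  simp_rw [lintegral_eq_lintegral_meas_lt _ (Eventually.of_forall f_nn) hf.measurable.aemeasurable]
  refine (lintegral_mono fun t => h_opens _ (hf.isOpen_preimage t)).trans ?_
  exact lintegral_liminf_le fun n => Antitone.measurable fun s t hst =>
    measure_mono fun ω hω => lt_of_le_of_lt hst hω

/-- The integral of a nonnegative lower semicontinuous function is lower semicontinuous with
respect to the weak convergence of probability measures. -/
theorem lowerSemicontinuous_lintegral [BorelSpace Y] [TopologicalSpace.PseudoMetrizableSpace Y]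
    [SecondCountableTopology Y] {f : Y → ℝ≥0∞} (hf : LowerSemicontinuous f) :
    LowerSemicontinuous fun P : ProbabilityMeasure Y => ∫⁻ y, f y ∂(P : Measure Y) := by
  -- Truncation at height `m` reduces to finite-valued functions; a supremum of lower semicontinuous
  -- functionals is lower semicontinuous.
  have hsup : ∀ P : ProbabilityMeasure Y, ∫⁻ y, f y ∂(P : Measure Y) =
      ⨆ m : ℕ, ∫⁻ y, min (f y) m ∂(P : Measure Y) := by
    intro P
    rw [← lintegral_iSup (fun m => hf.measurable.min measurable_const)]
    · refine lintegral_congr fun y => ?_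
      refine le_antisymm ?_ (iSup_le fun m => min_le_left _ _)
      refine le_of_forall_lt fun c hc => ?_
      obtain ⟨m, hm⟩ := ENNReal.exists_nat_gt (hc.trans_le le_top).ne
      exact (lt_min hc hm).trans_le (le_iSup (fun m : ℕ => min (f y) m) m)
    · intro m n hmn y
      exact min_le_min le_rfl (by exact_mod_cast hmn)
  simp_rw [hsup]
  refine lowerSemicontinuous_iSup fun m => ?_
  rw [lowerSemicontinuous_iff_isClosed_preimage]
  intro b
  refine IsSeqClosed.isClosed fun Ps P hPs hP => ?_
  set g : Y → ℝ := fun y => (min (f y) m).toReal with hg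
  have htop : ∀ y, min (f y) (m : ℝ≥0∞) ≠ ⊤ := fun y =>
    ((min_le_right _ _).trans_lt (ENNReal.natCast_lt_top m)).ne
  have hgf : ∀ y, ENNReal.ofReal (g y) = min (f y) m := fun y => ENNReal.ofReal_toReal (htop y)
  have hgl : LowerSemicontinuous g := by
    rw [lowerSemicontinuous_iff_isOpen_preimage]
    intro t
    rcases lt_or_ge t 0 with ht | ht
    · convert! isOpen_univ
      ext y
      simpa using ht.trans_le ENNReal.toReal_nonneg
    · have h1 : LowerSemicontinuous fun y => min (f y) (m : ℝ≥0∞) :=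
        hf.inf lowerSemicontinuous_const
      convert! h1.isOpen_preimage (ENNReal.ofReal t) using 1
      ext y
      simp only [Set.mem_preimage, Set.mem_Ioi, hg]
      rw [ENNReal.ofReal_lt_iff_lt_toReal ht (htop y)]
  have key := lintegral_ofReal_le_liminf_of_lowerSemicontinuous (μ := (P : Measure Y))
    (μs := fun n => (Ps n : Measure Y)) hgl (fun y => ENNReal.toReal_nonneg)
    (fun G hG => ProbabilityMeasure.le_liminf_measure_open_of_tendsto hP hG)
  simp_rw [hgf] at key
  refine key.trans ?_
  refine (liminf_le_liminf (v := fun _ => b) (Eventually.of_forall fun n => hPs n)).trans ?_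
  simp

end LowerSemicontinuity

/-! ### The compactified space and the Coulomb cost on it. -/

section OnePointCompactification

variable {d : ℕ}

instance instMeasurableSpaceOnePoint {X : Type*} [TopologicalSpace X] :
    MeasurableSpace (OnePoint X) := borel _

instance instBorelSpaceOnePoint {X : Type*} [TopologicalSpace X] : BorelSpace (OnePoint X) := ⟨rfl⟩

/-- The one-point compactification of `ℝ^d` is a sphere. -/
noncomputable def onePointHomeoSphere (d : ℕ) :
    OnePoint (EuclideanSpace ℝ (Fin d)) ≃ₜ
      Metric.sphere (0 : EuclideanSpace ℝ (Fin (d + 1))) 1 :=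
  onePointEquivSphereOfFinrankEq (by simp)

instance instMetrizableSpaceOnePoint :
    TopologicalSpace.MetrizableSpace (OnePoint (EuclideanSpace ℝ (Fin d))) :=
  (onePointHomeoSphere d).isEmbedding.metrizableSpace

instance instSecondCountableTopologyOnePoint :
    SecondCountableTopology (OnePoint (EuclideanSpace ℝ (Fin d))) :=
  (onePointHomeoSphere d).isEmbedding.secondCountableTopology

theorem OnePoint.measurableEmbedding_coe {X : Type*} [TopologicalSpace X] [MeasurableSpace X]
    [BorelSpace X] : MeasurableEmbedding ((↑) : X → OnePoint X) :=
  OnePoint.isOpenEmbedding_coe.measurableEmbedding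

/-- The Coulomb kernel, extended by `0` when one of the points is at infinity. -/
noncomputable def extKernel (a b : OnePoint (EuclideanSpace ℝ (Fin d))) : ℝ≥0∞ :=
  match a, b with
  | OnePoint.some x, OnePoint.some y => ‖x - y‖ₑ⁻¹
  | OnePoint.some _, OnePoint.infty => 0
  | OnePoint.infty, _ => 0

theorem extKernel_coe (x y : EuclideanSpace ℝ (Fin d)) :
    extKernel (x : OnePoint (EuclideanSpace ℝ (Fin d))) y = ‖x - y‖ₑ⁻¹ := rfl

theorem extKernel_infty_left (b : OnePoint (EuclideanSpace ℝ (Fin d))) :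
    extKernel OnePoint.infty b = 0 := rfl

theorem extKernel_infty_right (a : OnePoint (EuclideanSpace ℝ (Fin d))) :
    extKernel a OnePoint.infty = 0 := by
  induction a using OnePoint.rec <;> rfl

theorem extKernel_comm (a b : OnePoint (EuclideanSpace ℝ (Fin d))) :
    extKernel a b = extKernel b a := by
  induction a using OnePoint.rec with
  | infty => rw [extKernel_infty_left, extKernel_infty_right]
  | coe x =>
    induction b using OnePoint.rec with
    | infty => rw [extKernel_infty_left, extKernel_infty_right]
    | coe y => rw [extKernel_coe, extKernel_coe, ← enorm_neg, neg_sub]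

theorem lowerSemicontinuous_extKernel :
    LowerSemicontinuous fun p : OnePoint (EuclideanSpace ℝ (Fin d)) ×
      OnePoint (EuclideanSpace ℝ (Fin d)) => extKernel p.1 p.2 := by
  have hzero : ∀ p : OnePoint (EuclideanSpace ℝ (Fin d)) × OnePoint (EuclideanSpace ℝ (Fin d)),
      extKernel p.1 p.2 = 0 → LowerSemicontinuousAt (fun p :
        OnePoint (EuclideanSpace ℝ (Fin d)) × OnePoint (EuclideanSpace ℝ (Fin d)) =>
          extKernel p.1 p.2) p := by
    -- Where the kernel vanishes there is nothing to prove: no value of `[0, ∞]` lies below `0`.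
    intro p hp y hy
    simp [hp] at hy
  rintro ⟨a, b⟩
  induction a using OnePoint.rec with
  | infty => exact hzero _ (extKernel_infty_left b)
  | coe x =>
    induction b using OnePoint.rec with
    | infty => exact hzero _ (extKernel_infty_right _)
    | coe y =>
      -- At finite points, the diagonal included, the kernel is continuous into `[0, ∞]`; `ℝ^d`
      -- being open in the compactification, this is checked in `ℝ^d`.
      apply ContinuousAt.lowerSemicontinuousAt
      have hemb := (OnePoint.isOpenEmbedding_coe (X := EuclideanSpace ℝ (Fin d))).prodMap
        (OnePoint.isOpenEmbedding_coe (X := EuclideanSpace ℝ (Fin d)))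
      have := hemb.continuousAt_iff (g := fun p : OnePoint (EuclideanSpace ℝ (Fin d)) ×
        OnePoint (EuclideanSpace ℝ (Fin d)) => extKernel p.1 p.2) (x := (x, y))
      refine this.1 ?_
      change ContinuousAt (fun q : EuclideanSpace ℝ (Fin d) × EuclideanSpace ℝ (Fin d) =>
        ‖q.1 - q.2‖ₑ⁻¹) (x, y)
      fun_prop

/-- The Coulomb cost of `N` points of the one-point compactification of `ℝ^d`; points at infinity
do not interact. -/
noncomputable def extCost (N : ℕ) (x : Fin N → OnePoint (EuclideanSpace ℝ (Fin d))) : ℝ≥0∞ :=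
  ∑ i, ∑ j ∈ Finset.Ioi i, extKernel (x i) (x j)

theorem lowerSemicontinuous_extCost (N : ℕ) :
    LowerSemicontinuous (extCost (d := d) N) := by
  refine lowerSemicontinuous_sum fun i _ => lowerSemicontinuous_sum fun j _ => ?_
  exact lowerSemicontinuous_extKernel.comp (f := fun p : OnePoint (EuclideanSpace ℝ (Fin d)) ×
    OnePoint (EuclideanSpace ℝ (Fin d)) => extKernel p.1 p.2)
    (g := fun x : Fin N → OnePoint (EuclideanSpace ℝ (Fin d)) => (x i, x j)) (by fun_prop)

theorem measurable_extCost (N : ℕ) : Measurable (extCost (d := d) N) :=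
  (lowerSemicontinuous_extCost N).measurable

theorem measurable_coulombCost (N : ℕ) : Measurable (coulombCost (d := d) N) := by
  unfold coulombCost
  fun_prop

/-- Relabelling the points does not increase the Coulomb cost. -/
theorem coulombCost_comp_le {N k : ℕ} (x : Fin N → EuclideanSpace ℝ (Fin d)) (f : Fin k ↪ Fin N) :
    coulombCost k (fun i => x (f i)) ≤ coulombCost N x :=
  sum_Ioi_comp_embedding_le (fun i j => ‖x i - x j‖ₑ⁻¹)
    (fun a b => by rw [← enorm_neg, neg_sub]) f

end OnePointCompactification

/-! ### Upper bound: recovery sequences with points sent to infinity. -/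

section Recovery

variable {d : ℕ}

/-- Completes a configuration of `k` points of `ℝ^d` to one of `N` points: the new points lie on
the half-line spanned by `e`, at distance at least `n` from one another and from the old ones. -/
noncomputable def addFarPoints (N : ℕ) (e : EuclideanSpace ℝ (Fin d)) (n k : ℕ)
    (x : Fin k → EuclideanSpace ℝ (Fin d)) (j : Fin N) : EuclideanSpace ℝ (Fin d) :=
  if h : j.val < k then x ⟨j, h⟩ else ((n : ℝ) * (j.val + 1) + ∑ i, ‖x i‖) • e

variable {N : ℕ} {e : EuclideanSpace ℝ (Fin d)}

theorem measurable_addFarPoints (n k : ℕ) : Measurable (addFarPoints N e n k) := by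
  refine measurable_pi_lambda _ fun j => ?_
  unfold addFarPoints
  split_ifs with h
  · fun_prop
  · fun_prop

theorem addFarPoints_of_lt {n k : ℕ} (x : Fin k → EuclideanSpace ℝ (Fin d)) {j : Fin N}
    (h : j.val < k) : addFarPoints N e n k x j = x ⟨j, h⟩ := dif_pos h

theorem addFarPoints_of_le {n k : ℕ} (x : Fin k → EuclideanSpace ℝ (Fin d)) {j : Fin N}
    (h : k ≤ j.val) :
    addFarPoints N e n k x j = ((n : ℝ) * (j.val + 1) + ∑ i, ‖x i‖) • e := dif_neg h.not_gt

theorem le_norm_addFarPoints (he : ‖e‖ = 1) {n k : ℕ} (x : Fin k → EuclideanSpace ℝ (Fin d))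
    {j : Fin N} (h : k ≤ j.val) : (n : ℝ) ≤ ‖addFarPoints N e n k x j‖ := by
  rw [addFarPoints_of_le x h, norm_smul, he, mul_one]
  refine le_trans ?_ (le_abs_self _)
  have h1 : 0 ≤ ∑ i, ‖x i‖ := Finset.sum_nonneg fun i _ => norm_nonneg _
  have h2 : (0 : ℝ) ≤ n * j.val := by positivity
  linarith

/-- The term `∑ ‖x i‖` in the position of a new point absorbs the norm of any old point; two new
points differ by `n (j - i) • e`. -/
theorem le_norm_addFarPoints_sub (he : ‖e‖ = 1) {n k : ℕ}
    (x : Fin k → EuclideanSpace ℝ (Fin d)) {i j : Fin N} (hij : i < j) (h : k ≤ j.val) :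
    (n : ℝ) ≤ ‖addFarPoints N e n k x i - addFarPoints N e n k x j‖ := by
  rw [norm_sub_rev]
  have hij' : (i.val : ℝ) + 1 ≤ j.val := by exact_mod_cast hij
  have h2 : (0 : ℝ) ≤ n * j.val := by positivity
  rcases lt_or_ge i.val k with hi | hi
  · have h0 := norm_sub_norm_le (addFarPoints N e n k x j) (addFarPoints N e n k x i)
    rw [addFarPoints_of_le x h, addFarPoints_of_lt x hi, norm_smul, he, mul_one] at *
    have h1 : ‖x ⟨i, hi⟩‖ ≤ ∑ i, ‖x i‖ :=
      Finset.single_le_sum (f := fun i => ‖x i‖) (fun i _ => norm_nonneg _) (Finset.mem_univ _)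
    have h3 := le_abs_self ((n : ℝ) * (j.val + 1) + ∑ i, ‖x i‖)
    rw [← Real.norm_eq_abs] at h3
    linarith
  · rw [addFarPoints_of_le x h, addFarPoints_of_le x hi, ← sub_smul, norm_smul, he, mul_one]
    refine le_trans ?_ (le_abs_self _)
    have : (n : ℝ) * (i.val + 1) ≤ n * j.val := by gcongr
    linarith

/-- A pair `i < j` with `j < k` is an old pair. Each of the other pairs, at most `N * N` in number,
involves a new point and costs at most `1 / n`. -/
theorem coulombCost_addFarPoints_le (he : ‖e‖ = 1) (n : ℕ) {k : ℕ} (hk : k ≤ N)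
    (x : Fin k → EuclideanSpace ℝ (Fin d)) :
    coulombCost N (addFarPoints N e n k x) ≤ coulombCost k x + (N * N : ℕ) * (n : ℝ≥0∞)⁻¹ := by
  unfold coulombCost
  rw [sum_Ioi_eq_sum_pairs, sum_Ioi_eq_sum_pairs,
    ← Finset.sum_filter_add_sum_filter_not _ (fun p : Fin N × Fin N => p.2.val < k)]
  refine add_le_add (le_of_eq ?_) ?_
  · symm
    refine Finset.sum_nbij (Prod.map (Fin.castLE hk) (Fin.castLE hk)) ?_ ?_ ?_ ?_
    · intro p hp
      simpa using hp
    · exact (Function.Injective.prodMap (Fin.castLE_injective hk)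
        (Fin.castLE_injective hk)).injOn
    · rintro ⟨i, j⟩ hp
      simp only [Finset.coe_filter, Finset.mem_filter, Finset.mem_univ, true_and,
        Set.mem_ofPred_eq] at hp
      refine ⟨(⟨i, lt_trans hp.1 hp.2⟩, ⟨j, hp.2⟩), by simpa using hp.1, rfl⟩
    · rintro ⟨i, j⟩ hp
      rw [Prod.map_apply, addFarPoints_of_lt x (by simp : (Fin.castLE hk i).val < k),
        addFarPoints_of_lt x (by simp : (Fin.castLE hk j).val < k)]
      rfl
  · refine (Finset.sum_le_card_nsmul _ _ (n : ℝ≥0∞)⁻¹ ?_).trans ?_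
    · rintro ⟨i, j⟩ hp
      simp only [Finset.mem_filter, Finset.mem_univ, true_and, not_lt] at hp
      rw [ENNReal.inv_le_inv, ← ofReal_norm, ← ENNReal.ofReal_natCast]
      exact ENNReal.ofReal_le_ofReal (le_norm_addFarPoints_sub he x hp.1 hp.2)
    · rw [nsmul_eq_mul]
      gcongr
      refine (Finset.card_le_univ _).trans ?_
      simp

/-- The average of the marginals of a probability on `(ℝ^d)^N` is the common marginal of its cyclic
symmetrization, which does not cost more. -/
theorem transportCost_average_le (hN : 1 ≤ N) (P : Measure (Fin N → EuclideanSpace ℝ (Fin d)))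
    [IsProbabilityMeasure P] :
    transportCost N ((N : ℝ≥0∞)⁻¹ • ∑ s : Fin N, P.map (fun x => x s)) ≤
      ∫⁻ x, coulombCost N x ∂P := by
  have : NeZero N := ⟨by omega⟩
  have hN0 : (N : ℝ≥0∞) ≠ 0 := by exact_mod_cast (NeZero.ne N)
  have hm : ∀ s : Fin N, Measurable
      (fun (x : Fin N → EuclideanSpace ℝ (Fin d)) (i : Fin N) => x (i + s)) := fun s => by fun_prop
  set R : Measure (Fin N → EuclideanSpace ℝ (Fin d)) :=
    (N : ℝ≥0∞)⁻¹ • ∑ s : Fin N, P.map (fun x i => x (i + s)) with hR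
  have hprob : IsProbabilityMeasure R := by
    constructor
    simp only [hR, Measure.smul_apply, Measure.finsetSum_apply, smul_eq_mul]
    simp_rw [Measure.map_apply (hm _) MeasurableSet.univ]
    simp [ENNReal.inv_mul_cancel hN0]
  have hmarg : ∀ i : Fin N, R.map (fun x => x i) =
      (N : ℝ≥0∞)⁻¹ • ∑ s : Fin N, P.map (fun x => x s) := by
    intro i
    rw [hR, Measure.map_smul, Measure.map_finset_sum (measurable_pi_apply i).aemeasurable]
    congr 1
    refine (Finset.sum_congr rfl fun s _ => ?_).trans
      (Equiv.sum_comp (Equiv.addLeft i) (fun s => P.map (fun x => x s)))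
    exact Measure.map_map (measurable_pi_apply i) (hm _)
  refine (iInf₂_le R ⟨hprob, hmarg⟩).trans ?_
  rw [hR, lintegral_smul_measure, lintegral_finsetSum_measure]
  have hle : ∀ s ∈ (Finset.univ : Finset (Fin N)),
      ∫⁻ x, coulombCost N x ∂(P.map (fun x i => x (i + s))) ≤ ∫⁻ x, coulombCost N x ∂P := by
    intro s _
    rw [lintegral_map (measurable_coulombCost N) (hm s)]
    exact lintegral_mono fun x => coulombCost_comp_le x (Equiv.addRight s).toEmbedding
  calc (N : ℝ≥0∞)⁻¹ • ∑ s : Fin N, ∫⁻ x, coulombCost N x ∂(P.map (fun x i => x (i + s)))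
      ≤ (N : ℝ≥0∞)⁻¹ • (Finset.card (Finset.univ : Finset (Fin N)) •
          ∫⁻ x, coulombCost N x ∂P) := by
        rw [smul_eq_mul, smul_eq_mul]
        gcongr
        exact Finset.sum_le_card_nsmul _ _ _ hle
    _ = ∫⁻ x, coulombCost N x ∂P := by
        rw [Finset.card_fin, smul_eq_mul, nsmul_eq_mul, ← mul_assoc,
          ENNReal.inv_mul_cancel hN0 (ENNReal.natCast_ne_top N), one_mul]

/-- The integrals of a function vanishing at infinity, evaluated at an added point, tend to `0`. -/
theorem tendsto_integral_addFarPoints (he : ‖e‖ = 1) {k : ℕ}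
    (R : Measure (Fin k → EuclideanSpace ℝ (Fin d))) [IsFiniteMeasure R]
    (φ : C₀(EuclideanSpace ℝ (Fin d), ℝ)) {j : Fin N} (h : k ≤ j.val) :
    Tendsto (fun n : ℕ => ∫ x, φ (addFarPoints N e n k x j) ∂(R)) atTop (𝓝 0) := by
  have hφ0 : Tendsto φ (Filter.cocompact _) (𝓝 0) := φ.zero_at_infty'
  have hbd : ∀ y, ‖φ y‖ ≤ ‖φ.toBCF‖ := fun y => φ.toBCF.norm_coe_le_norm y
  have := tendsto_integral_of_dominated_convergence (μ := R)
    (F := fun (n : ℕ) x => φ (addFarPoints N e n k x j)) (f := fun _ => 0)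
    (fun _ => ‖φ.toBCF‖) (fun n => ?_) (integrable_const _)
    (fun n => Eventually.of_forall fun x => hbd _) (Eventually.of_forall fun x => ?_)
  · simpa using this
  · have h1 : Measurable fun x => addFarPoints N e n k x j :=
      (measurable_pi_apply j).comp (measurable_addFarPoints n k)
    exact (φ.continuous.measurable.comp h1).aestronglyMeasurable
  · refine hφ0.comp ?_
    rw [← Metric.cobounded_eq_cocompact, ← tendsto_norm_atTop_iff_cobounded]
    exact tendsto_atTop_mono (fun n => le_norm_addFarPoints he x h) tendsto_natCast_atTop_atTop

theorem relaxedCost_le_sum_lintegral (hd : 1 ≤ d) (hN : 1 ≤ N)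
    {ρ : Measure (EuclideanSpace ℝ (Fin d))} {ν : ℕ → Measure (EuclideanSpace ℝ (Fin d))}
    (hν : ν ∈ stratifications N ρ) (Q : ∀ k, Measure (Fin k → EuclideanSpace ℝ (Fin d)))
    (hQ : ∀ k ∈ Finset.Icc 1 N, Q k ∈ partialPlans k (ν k)) :
    relaxedCost N ρ ≤ ∑ k ∈ Finset.Icc 1 N, ∫⁻ x, coulombCost k x ∂(Q k) := by
  obtain ⟨hν1, hνsum, hνmass⟩ := hν
  -- `1 ≤ d` supplies a direction in which to escape.
  set e : EuclideanSpace ℝ (Fin d) := EuclideanSpace.single ⟨0, hd⟩ (1 : ℝ) with he_def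
  have he : ‖e‖ = 1 := by simp [he_def]
  have hN0 : (N : ℝ≥0∞) ≠ 0 := by exact_mod_cast (by omega : N ≠ 0)
  have hrange : ∀ {M : Type} [AddCommMonoid M] (F : ℕ → M),
      ∑ k ∈ Finset.range (N + 1), F k = F 0 + ∑ k ∈ Finset.Icc 1 N, F k := by
    intro M _ F
    rw [Finset.range_eq_Ico, Finset.sum_eq_sum_Ico_succ_bot (by omega)]
    rfl
  -- The stratum `k = 0`, a multiple of the Dirac mass on the empty configuration, brings the total
  -- mass to `1`.
  set R : ∀ k, Measure (Fin k → EuclideanSpace ℝ (Fin d)) := fun k =>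
    if k = 0 then (1 - ∑ k ∈ Finset.Icc 1 N, ν k Set.univ) • Measure.dirac 0 else Q k with hR
  have hRQ : ∀ k ∈ Finset.Icc 1 N, R k = Q k := fun k hk => by
    rw [hR]; exact if_neg (by have := (Finset.mem_Icc.1 hk).1; omega)
  have hR0 : R 0 = (1 - ∑ k ∈ Finset.Icc 1 N, ν k Set.univ) • Measure.dirac 0 := if_pos rfl
  have hmass : ∑ k ∈ Finset.range (N + 1), R k Set.univ = 1 := by
    rw [hrange, Finset.sum_congr rfl fun k hk => by rw [hRQ k hk, (hQ k hk).1], hR0]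
    simp [tsub_add_cancel_of_le hνmass]
  have hfin : ∀ k ∈ Finset.range (N + 1), IsFiniteMeasure (R k) := fun k hk => ⟨by
    refine (Finset.single_le_sum (f := fun k => R k Set.univ) (fun _ _ => zero_le) hk).trans_lt ?_
    rw [hmass]; exact ENNReal.one_lt_top⟩
  have hνfin : ∀ k ∈ Finset.Icc 1 N, IsFiniteMeasure (ν k) := fun k hk =>
    ⟨(hν1 k hk).trans_lt ENNReal.one_lt_top⟩
  set P : ℕ → Measure (Fin N → EuclideanSpace ℝ (Fin d)) := fun n =>
    ∑ k ∈ Finset.range (N + 1), (R k).map (addFarPoints N e n k) with hP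
  have hPprob : ∀ n, IsProbabilityMeasure (P n) := fun n => ⟨by
    simp only [hP, Measure.finsetSum_apply]
    rw [← hmass]
    refine Finset.sum_congr rfl fun k _ => ?_
    rw [Measure.map_apply (measurable_addFarPoints n k) MeasurableSet.univ, Set.preimage_univ]⟩
  set ρs : ℕ → Measure (EuclideanSpace ℝ (Fin d)) := fun n =>
    (N : ℝ≥0∞)⁻¹ • ∑ s : Fin N, (P n).map (fun x => x s) with hρs
  have hρsprob : ∀ n, IsProbabilityMeasure (ρs n) := fun n => ⟨by
    simp only [hρs, Measure.smul_apply, Measure.finsetSum_apply, smul_eq_mul]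
    simp_rw [Measure.map_apply (measurable_pi_apply _) MeasurableSet.univ]
    simp [ENNReal.inv_mul_cancel hN0]⟩
  have hweak : WeakStarTendsto ρs ρ := by
    intro φ
    have hbd : ∀ (μ : Measure (EuclideanSpace ℝ (Fin d))) [IsFiniteMeasure μ],
        Integrable φ μ := fun μ _ => φ.toBCF.integrable μ
    have hint : ∀ n, ∫ x, φ x ∂(ρs n) = (N : ℝ)⁻¹ * ∑ s : Fin N, ∑ k ∈ Finset.range (N + 1),
        ∫ x, φ (addFarPoints N e n k x s) ∂(R k) := by
      intro n
      have hmap : ∀ s : Fin N, (P n).map (fun x => x s) = ∑ k ∈ Finset.range (N + 1),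
          (R k).map (fun x => addFarPoints N e n k x s) := by
        intro s
        rw [hP, Measure.map_finset_sum (measurable_pi_apply s).aemeasurable]
        refine Finset.sum_congr rfl fun k _ => ?_
        rw [Measure.map_map (measurable_pi_apply s) (measurable_addFarPoints n k)]
        rfl
      rw [hρs, integral_smul_measure, integral_finsetSum_measure]
      · simp only [ENNReal.toReal_inv, ENNReal.toReal_natCast, smul_eq_mul]
        congr 1
        refine Finset.sum_congr rfl fun s _ => ?_
        rw [hmap, integral_finsetSum_measure]
        · refine Finset.sum_congr rfl fun k _ => ?_
          rw [integral_map]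
          · exact ((measurable_pi_apply s).comp (measurable_addFarPoints n k)).aemeasurable
          · exact φ.continuous.measurable.aestronglyMeasurable
        · intro k hk
          have := hfin k hk
          exact hbd _
      · intro s _
        exact hbd _
    have hlim : ∀ s : Fin N, ∀ k ∈ Finset.range (N + 1),
        Tendsto (fun n : ℕ => ∫ x, φ (addFarPoints N e n k x s) ∂(R k)) atTop
          (𝓝 (if s.val < k then ∫ x, φ x ∂(ν k) else 0)) := by
      intro s k hk
      have := hfin k hk
      split_ifs with hs
      · have hk' : k ∈ Finset.Icc 1 N := by
          simp only [Finset.mem_Icc, Finset.mem_range] at hk ⊢; omega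
        have : ∀ n : ℕ, ∫ x, φ (addFarPoints N e n k x s) ∂(R k) = ∫ x, φ x ∂(ν k) := by
          intro n
          simp_rw [addFarPoints_of_lt _ hs]
          rw [← (hQ k hk').2 ⟨s, hs⟩, hRQ k hk']
          exact (integral_map (φ := fun x : Fin k → EuclideanSpace ℝ (Fin d) => x ⟨s.val, hs⟩)
            (measurable_pi_apply _).aemeasurable
            φ.continuous.measurable.aestronglyMeasurable).symm
        simp_rw [this]
        exact tendsto_const_nhds
      · exact tendsto_integral_addFarPoints he _ φ (not_lt.1 hs)
    simp_rw [hint]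
    have hρint : ∫ x, φ x ∂ρ = (N : ℝ)⁻¹ * ∑ s : Fin N, ∑ k ∈ Finset.range (N + 1),
        (if s.val < k then ∫ x, φ x ∂(ν k) else 0) := by
      -- In stratum `k` exactly the `k` slots `s < k` keep a finite point; divided by `N`, this is
      -- the weight `k / N`.
      have hcount : ∀ k ∈ Finset.Icc 1 N, ∑ s : Fin N,
          (if s.val < k then ∫ x, φ x ∂(ν k) else 0) = k * ∫ x, φ x ∂(ν k) := by
        intro k hk
        have hk' := (Finset.mem_Icc.1 hk).2
        rw [Fin.sum_univ_eq_sum_range (fun s => if s < k then ∫ x, φ x ∂(ν k) else 0) N,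
          ← Finset.sum_filter]
        have : (Finset.range N).filter (fun s => s < k) = Finset.range k := by
          ext s
          simp only [Finset.mem_filter, Finset.mem_range]
          omega
        rw [this, Finset.sum_const, Finset.card_range, nsmul_eq_mul]
      rw [← hνsum, integral_finsetSum_measure, Finset.sum_comm, hrange,
        Finset.sum_congr rfl hcount]
      · simp only [not_lt_zero, if_false, Finset.sum_const_zero, zero_add, Finset.mul_sum]
        refine Finset.sum_congr rfl fun k _ => ?_
        rw [integral_smul_measure, ENNReal.toReal_div, ENNReal.toReal_natCast,
          ENNReal.toReal_natCast, smul_eq_mul]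
        ring
      · intro k hk
        have := hνfin k hk
        refine (hbd _).smul_measure ?_
        exact ENNReal.div_ne_top (ENNReal.natCast_ne_top k) hN0
    rw [hρint]
    exact (tendsto_finsetSum _ fun s _ => tendsto_finsetSum _ fun k hk => hlim s k hk).const_mul _
  have hcost : ∀ n : ℕ, transportCost N (ρs n) ≤
      ∑ k ∈ Finset.Icc 1 N, ∫⁻ x, coulombCost k x ∂(Q k) + (N * N : ℕ) * (n : ℝ≥0∞)⁻¹ := by
    intro n
    refine (transportCost_average_le hN (P n)).trans ?_
    calc ∫⁻ x, coulombCost N x ∂(P n)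
        = ∑ k ∈ Finset.range (N + 1), ∫⁻ x, coulombCost N (addFarPoints N e n k x) ∂(R k) := by
          rw [hP, lintegral_finsetSum_measure]
          exact Finset.sum_congr rfl fun k _ =>
            lintegral_map (measurable_coulombCost N) (measurable_addFarPoints n k)
      _ ≤ ∑ k ∈ Finset.range (N + 1), ∫⁻ x, (coulombCost k x + (N * N : ℕ) * (n : ℝ≥0∞)⁻¹) ∂(R k) :=
          Finset.sum_le_sum fun k hk => lintegral_mono fun x =>
            coulombCost_addFarPoints_le he n (by simp at hk; omega) x
      _ = ∑ k ∈ Finset.range (N + 1), ∫⁻ x, coulombCost k x ∂(R k) +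
            (N * N : ℕ) * (n : ℝ≥0∞)⁻¹ := by
          simp_rw [lintegral_add_right _ measurable_const, lintegral_const]
          rw [Finset.sum_add_distrib, ← Finset.mul_sum, hmass, mul_one]
      _ = _ := by
          rw [hrange, Finset.sum_congr rfl fun k hk => by rw [hRQ k hk]]
          congr 1
          simp [coulombCost]
  have htend : Tendsto (fun n : ℕ => ∑ k ∈ Finset.Icc 1 N, ∫⁻ x, coulombCost k x ∂(Q k) +
      (N * N : ℕ) * (n : ℝ≥0∞)⁻¹) atTop
      (𝓝 (∑ k ∈ Finset.Icc 1 N, ∫⁻ x, coulombCost k x ∂(Q k))) := by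
    have h0 : Tendsto (fun n : ℕ => ((N * N : ℕ) : ℝ≥0∞) * (n : ℝ≥0∞)⁻¹) atTop (𝓝 0) := by
      simpa using ENNReal.Tendsto.const_mul ENNReal.tendsto_inv_nat_nhds_zero
        (Or.inr (ENNReal.natCast_ne_top (N * N)))
    simpa using tendsto_const_nhds.add h0
  refine (iInf₂_le ρs ⟨hρsprob, hweak⟩).trans ?_
  rw [← htend.liminf_eq]
  exact liminf_le_liminf (Eventually.of_forall hcost)

theorem relaxedCost_le_sum_partialCost (hd : 1 ≤ d) (hN : 1 ≤ N)
    {ρ : Measure (EuclideanSpace ℝ (Fin d))} {ν : ℕ → Measure (EuclideanSpace ℝ (Fin d))}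
    (hν : ν ∈ stratifications N ρ) :
    relaxedCost N ρ ≤ ∑ k ∈ Finset.Icc 1 N, partialCost k (ν k) := by
  -- Plans that are optimal up to `ε / N` in each stratum are available only for finite costs.
  by_cases htop : ∃ k ∈ Finset.Icc 1 N, partialCost k (ν k) = ⊤
  · rw [ENNReal.sum_eq_top.2 htop]
    exact le_top
  push Not at htop
  refine ENNReal.le_of_forall_pos_le_add fun ε hε _ => ?_
  have hNpos : (0 : ℝ≥0∞) < N := by exact_mod_cast hN
  have hε' : (ε : ℝ≥0∞) / N ≠ 0 :=
    (ENNReal.div_pos (by exact_mod_cast hε.ne') (ENNReal.natCast_ne_top N)).ne'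
  have hex : ∀ k, ∃ Q : Measure (Fin k → EuclideanSpace ℝ (Fin d)), k ∈ Finset.Icc 1 N →
      Q ∈ partialPlans k (ν k) ∧
        ∫⁻ x, coulombCost k x ∂Q < partialCost k (ν k) + (ε : ℝ≥0∞) / N := by
    intro k
    by_cases hk : k ∈ Finset.Icc 1 N
    · have hlt : partialCost k (ν k) < partialCost k (ν k) + (ε : ℝ≥0∞) / N :=
        ENNReal.lt_add_right (htop k hk) hε'
      simp only [partialCost, iInf_lt_iff] at hlt
      obtain ⟨Q, hQ, h⟩ := hlt
      exact ⟨Q, fun _ => ⟨hQ, h⟩⟩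
    · exact ⟨0, fun h => absurd h hk⟩
  choose Q hQ using hex
  refine (relaxedCost_le_sum_lintegral hd hN hν Q fun k hk => (hQ k hk).1).trans ?_
  refine (Finset.sum_le_sum fun k hk => (hQ k hk).2.le).trans ?_
  rw [Finset.sum_add_distrib]
  gcongr
  simp only [Finset.sum_const, Nat.card_Icc, Nat.add_sub_cancel, nsmul_eq_mul]
  exact ENNReal.mul_div_le

end Recovery

/-! ### Cutting a plan according to its points at infinity. -/

section Strata

variable {d N : ℕ}

/-- The inverse of the inclusion of `ℝ^d` into its one-point compactification, with value `0` at
infinity. -/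
noncomputable def finitePart : OnePoint (EuclideanSpace ℝ (Fin d)) → EuclideanSpace ℝ (Fin d) :=
  Function.extend (↑) id 0

theorem measurable_finitePart : Measurable (finitePart (d := d)) :=
  OnePoint.measurableEmbedding_coe.measurable_extend measurable_id measurable_zero

theorem finitePart_coe (x : EuclideanSpace ℝ (Fin d)) :
    finitePart (x : OnePoint (EuclideanSpace ℝ (Fin d))) = x :=
  OnePoint.coe_injective.extend_apply _ _ _

open Classical in
/-- The indices of the points that are not at infinity. -/
noncomputable def finiteIndices (x : Fin N → OnePoint (EuclideanSpace ℝ (Fin d))) :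
    Finset (Fin N) :=
  Finset.univ.filter fun a => x a ≠ OnePoint.infty

theorem mem_finiteIndices {x : Fin N → OnePoint (EuclideanSpace ℝ (Fin d))} {a : Fin N} :
    a ∈ finiteIndices x ↔ x a ≠ OnePoint.infty := by
  simp [finiteIndices]

theorem measurableSet_finiteIndices_eq (S : Finset (Fin N)) :
    MeasurableSet {x : Fin N → OnePoint (EuclideanSpace ℝ (Fin d)) | S = finiteIndices x} := by
  have hset : {x : Fin N → OnePoint (EuclideanSpace ℝ (Fin d)) | S = finiteIndices x} =
      ⋂ a, {x | a ∈ S ↔ x a ≠ OnePoint.infty} := by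
    ext x
    simp [Finset.ext_iff, mem_finiteIndices]
  rw [hset]
  refine MeasurableSet.iInter fun a => ?_
  have h : MeasurableSet {x : Fin N → OnePoint (EuclideanSpace ℝ (Fin d)) |
      x a = OnePoint.infty} :=
    (measurableSet_singleton OnePoint.infty).preimage (measurable_pi_apply a)
  by_cases ha : a ∈ S
  · simp only [ha, true_iff]
    exact h.compl
  · simpa [ha] using h

/-- The uniform probability on the injections `Fin k → Fin N` with range `S`. -/
noncomputable def embeddingWeight {k : ℕ} (f : Fin k ↪ Fin N) (S : Finset (Fin N)) : ℝ≥0∞ :=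
  if Finset.univ.map f = S then
    (Finset.card {g : Fin k ↪ Fin N | Finset.univ.map g = S} : ℝ≥0∞)⁻¹ else 0

theorem embeddingWeight_of_ne {k : ℕ} {f : Fin k ↪ Fin N} {S : Finset (Fin N)}
    (h : Finset.univ.map f ≠ S) : embeddingWeight f S = 0 := if_neg h

theorem sum_embeddingWeight (k : ℕ) (S : Finset (Fin N)) :
    ∑ f : Fin k ↪ Fin N, embeddingWeight f S = if S.card = k then 1 else 0 := by
  split_ifs with h
  · unfold embeddingWeight
    rw [← Finset.sum_filter, Finset.sum_const, nsmul_eq_mul]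
    refine ENNReal.mul_inv_cancel ?_ (ENNReal.natCast_ne_top _)
    have hne : Finset.Nonempty {g : Fin k ↪ Fin N | Finset.univ.map g = S} :=
      ⟨(S.orderEmbOfFin h).toEmbedding, by simp⟩
    exact_mod_cast hne.card_pos.ne'
  · refine Finset.sum_eq_zero fun f _ => embeddingWeight_of_ne ?_
    rintro rfl
    simp at h

/-- The weights over all `k` and `f` add up to `1` if `S` is nonempty and to `0` otherwise, since `k
= 0` is left out. -/
theorem sum_Icc_sum_embeddingWeight_mul_le (S : Finset (Fin N)) (c : ℝ≥0∞)
    (F : ∀ k, (Fin k ↪ Fin N) → ℝ≥0∞)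
    (hF : ∀ k f, Finset.univ.map f = S → F k f ≤ c) :
    ∑ k ∈ Finset.Icc 1 N, ∑ f : Fin k ↪ Fin N, embeddingWeight f S * F k f ≤ c := by
  calc ∑ k ∈ Finset.Icc 1 N, ∑ f : Fin k ↪ Fin N, embeddingWeight f S * F k f
      ≤ ∑ k ∈ Finset.Icc 1 N, ∑ f : Fin k ↪ Fin N, embeddingWeight f S * c := by
        refine Finset.sum_le_sum fun k _ => Finset.sum_le_sum fun f _ => ?_
        by_cases h : Finset.univ.map f = S
        · exact mul_le_mul_right (hF k f h) _
        · simp [embeddingWeight_of_ne h]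
    _ = (∑ k ∈ Finset.Icc 1 N, if S.card = k then 1 else 0) * c := by
        rw [Finset.sum_mul]
        refine Finset.sum_congr rfl fun k _ => ?_
        rw [← Finset.sum_mul, sum_embeddingWeight]
    _ ≤ c := by
        refine mul_le_of_le_one_left' ?_
        rw [Finset.sum_ite_eq]
        split_ifs <;> simp

theorem sum_Icc_sum_embeddingWeight_mul_sum (S : Finset (Fin N)) (G : Fin N → ℝ≥0∞) :
    ∑ k ∈ Finset.Icc 1 N, ∑ f : Fin k ↪ Fin N, embeddingWeight f S * ∑ i, G (f i) =
      ∑ a ∈ S, G a := by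
  have h1 : ∀ k, ∑ f : Fin k ↪ Fin N, embeddingWeight f S * ∑ i, G (f i) =
      (if S.card = k then 1 else 0) * ∑ a ∈ S, G a := by
    intro k
    rw [← sum_embeddingWeight, Finset.sum_mul]
    refine Finset.sum_congr rfl fun f _ => ?_
    by_cases h : Finset.univ.map f = S
    · rw [← h, Finset.sum_map]
    · simp [embeddingWeight_of_ne h]
  simp_rw [h1]
  rw [← Finset.sum_mul, Finset.sum_ite_eq]
  split_ifs with h
  · rw [one_mul]
  -- The only cardinality outside `1, …, N` is `0`, for which the right-hand sum is empty too.
  · have hcard : S.card ≤ N := by simpa using S.card_le_univ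
    have : S = ∅ := by
      rw [← Finset.card_eq_zero]
      rw [Finset.mem_Icc] at h
      omega
    simp [this]

/-- The part of a measure on configurations of `N` points with exactly `k` points not at infinity,
seen as a measure on `(ℝ^d)^k` by averaging over the labellings of these points. -/
noncomputable def stratum (P : Measure (Fin N → OnePoint (EuclideanSpace ℝ (Fin d)))) (k : ℕ) :
    Measure (Fin k → EuclideanSpace ℝ (Fin d)) :=
  ∑ f : Fin k ↪ Fin N, (P.withDensity fun x => embeddingWeight f (finiteIndices x)).map
    fun x i => finitePart (x (f i))

theorem measurable_embeddingWeight {k : ℕ} (f : Fin k ↪ Fin N) :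
    Measurable fun x : Fin N → OnePoint (EuclideanSpace ℝ (Fin d)) =>
      embeddingWeight f (finiteIndices x) := by
  have : (fun x : Fin N → OnePoint (EuclideanSpace ℝ (Fin d)) =>
      embeddingWeight f (finiteIndices x)) =
      {x | Finset.univ.map f = finiteIndices x}.indicator
        fun _ => embeddingWeight f (Finset.univ.map f) := by
    ext x
    by_cases h : Finset.univ.map f = finiteIndices x
    · rw [Set.indicator_of_mem (by exact h), ← h]
    · rw [Set.indicator_of_notMem (by exact h), embeddingWeight_of_ne h]
  rw [this]
  exact measurable_const.indicator (measurableSet_finiteIndices_eq _)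

theorem measurable_finitePart_comp {k : ℕ} (f : Fin k ↪ Fin N) :
    Measurable fun (x : Fin N → OnePoint (EuclideanSpace ℝ (Fin d))) (i : Fin k) =>
      finitePart (x (f i)) :=
  measurable_pi_lambda _ fun i => measurable_finitePart.comp (measurable_pi_apply (f i))

theorem lintegral_stratum (P : Measure (Fin N → OnePoint (EuclideanSpace ℝ (Fin d)))) (k : ℕ)
    {g : (Fin k → EuclideanSpace ℝ (Fin d)) → ℝ≥0∞} (hg : Measurable g) :
    ∫⁻ y, g y ∂(stratum P k) = ∫⁻ x, ∑ f : Fin k ↪ Fin N,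
      embeddingWeight f (finiteIndices x) * g (fun i => finitePart (x (f i))) ∂P := by
  rw [stratum, lintegral_finsetSum_measure, lintegral_finsetSum]
  · refine Finset.sum_congr rfl fun f _ => ?_
    rw [lintegral_map hg (measurable_finitePart_comp f)]
    exact lintegral_withDensity_eq_lintegral_mul _ (measurable_embeddingWeight f)
      (hg.comp (measurable_finitePart_comp f))
  · exact fun f _ => (measurable_embeddingWeight f).mul (hg.comp (measurable_finitePart_comp f))

theorem sum_lintegral_stratum (P : Measure (Fin N → OnePoint (EuclideanSpace ℝ (Fin d))))
    {g : ∀ k, (Fin k → EuclideanSpace ℝ (Fin d)) → ℝ≥0∞} (hg : ∀ k, Measurable (g k)) :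
    ∑ k ∈ Finset.Icc 1 N, ∫⁻ y, g k y ∂(stratum P k) =
      ∫⁻ x, ∑ k ∈ Finset.Icc 1 N, ∑ f : Fin k ↪ Fin N,
        embeddingWeight f (finiteIndices x) * g k (fun i => finitePart (x (f i))) ∂P := by
  simp_rw [lintegral_stratum P _ (hg _)]
  rw [lintegral_finsetSum]
  exact fun k _ => Finset.measurable_fun_sum _ fun f _ =>
    (measurable_embeddingWeight f).mul ((hg k).comp (measurable_finitePart_comp f))

/-- This is why `stratum` averages over all labellings: precomposing `f` with the transposition of
`i` and `j` permutes the embeddings and keeps their range, hence their weight. -/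
theorem stratum_map_eval (P : Measure (Fin N → OnePoint (EuclideanSpace ℝ (Fin d)))) {k : ℕ}
    (i j : Fin k) :
    (stratum P k).map (fun y => y i) = (stratum P k).map (fun y => y j) := by
  refine Measure.ext_of_lintegral _ fun g hg => ?_
  rw [lintegral_map hg (measurable_pi_apply i), lintegral_map hg (measurable_pi_apply j),
    lintegral_stratum P k (g := fun y => g (y i)) (hg.comp (measurable_pi_apply i)),
    lintegral_stratum P k (g := fun y => g (y j)) (hg.comp (measurable_pi_apply j))]
  refine lintegral_congr fun x => ?_
  rw [← Equiv.sum_comp (Equiv.embeddingCongr (Equiv.swap i j) (Equiv.refl (Fin N)))]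
  refine Finset.sum_congr rfl fun f _ => ?_
  congr 1
  · unfold embeddingWeight
    have : Finset.univ.map ((Equiv.swap i j).embeddingCongr (Equiv.refl (Fin N)) f) =
        Finset.univ.map f := by
      ext a
      simp only [Finset.mem_map, Finset.mem_univ, true_and]
      exact (Equiv.swap i j).symm.exists_congr fun _ => Iff.rfl
    rw [this]
  · simp

/-- The common marginal of the stratum of order `k`. -/
noncomputable def stratumMarginal (P : Measure (Fin N → OnePoint (EuclideanSpace ℝ (Fin d))))
    (k : ℕ) : Measure (EuclideanSpace ℝ (Fin d)) :=
  (k : ℝ≥0∞)⁻¹ • ∑ i : Fin k, (stratum P k).map fun y => y i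

theorem stratumMarginal_eq (P : Measure (Fin N → OnePoint (EuclideanSpace ℝ (Fin d)))) {k : ℕ}
    (i : Fin k) : (stratum P k).map (fun y => y i) = stratumMarginal P k := by
  have hk : (k : ℝ≥0∞) ≠ 0 := by exact_mod_cast (Fin.pos i).ne'
  rw [stratumMarginal, Finset.sum_congr rfl fun j _ => stratum_map_eval P j i, Finset.sum_const,
    Finset.card_fin, ← Nat.cast_smul_eq_nsmul ℝ≥0∞, smul_smul,
    ENNReal.inv_mul_cancel hk (ENNReal.natCast_ne_top k), one_smul]

theorem stratumMarginal_univ (P : Measure (Fin N → OnePoint (EuclideanSpace ℝ (Fin d)))) {k : ℕ}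
    (hk : 1 ≤ k) : stratum P k Set.univ = stratumMarginal P k Set.univ := by
  rw [← stratumMarginal_eq P ⟨0, hk⟩, Measure.map_apply (measurable_pi_apply _) MeasurableSet.univ,
    Set.preimage_univ]

theorem stratum_mem_partialPlans (P : Measure (Fin N → OnePoint (EuclideanSpace ℝ (Fin d))))
    {k : ℕ} (hk : 1 ≤ k) : stratum P k ∈ partialPlans k (stratumMarginal P k) :=
  ⟨stratumMarginal_univ P hk, stratumMarginal_eq P⟩

theorem sum_stratumMarginal_univ_le (P : Measure (Fin N → OnePoint (EuclideanSpace ℝ (Fin d))))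
    [IsProbabilityMeasure P] :
    ∑ k ∈ Finset.Icc 1 N, stratumMarginal P k Set.univ ≤ 1 := by
  have h : ∀ k ∈ Finset.Icc 1 N, stratumMarginal P k Set.univ = ∫⁻ _, 1 ∂(stratum P k) := by
    intro k hk
    rw [← stratumMarginal_univ P (Finset.mem_Icc.1 hk).1, lintegral_one]
  rw [Finset.sum_congr rfl h,
    sum_lintegral_stratum P (g := fun _ _ => 1) (fun _ => measurable_const)]
  refine (lintegral_mono fun x => ?_).trans (by simp : ∫⁻ _, 1 ∂P ≤ 1)
  exact sum_Icc_sum_embeddingWeight_mul_le (finiteIndices x) 1 (fun _ _ => 1)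
    (fun _ _ _ => le_rfl)

theorem sum_partialCost_stratumMarginal_le
    (P : Measure (Fin N → OnePoint (EuclideanSpace ℝ (Fin d)))) :
    ∑ k ∈ Finset.Icc 1 N, partialCost k (stratumMarginal P k) ≤ ∫⁻ x, extCost N x ∂P := by
  calc ∑ k ∈ Finset.Icc 1 N, partialCost k (stratumMarginal P k)
      ≤ ∑ k ∈ Finset.Icc 1 N, ∫⁻ y, coulombCost k y ∂(stratum P k) :=
        Finset.sum_le_sum fun k hk =>
          iInf₂_le _ (stratum_mem_partialPlans P (Finset.mem_Icc.1 hk).1)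
    _ ≤ ∫⁻ x, extCost N x ∂P := by
        rw [sum_lintegral_stratum P (fun k => measurable_coulombCost k)]
        refine lintegral_mono fun x => sum_Icc_sum_embeddingWeight_mul_le (finiteIndices x) _
          (fun k f => coulombCost k fun i => finitePart (x (f i))) fun k f hf => ?_
        -- Embeddings whose range is `finiteIndices x` meet only finite points, so the default value
        -- of `finitePart` at infinity plays no role.
        have hx : ∀ i, x (f i) = ((finitePart (x (f i)) : EuclideanSpace ℝ (Fin d)) :
            OnePoint (EuclideanSpace ℝ (Fin d))) := by
          intro i
          have hi : f i ∈ finiteIndices x := by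
            rw [← hf]; simp
          obtain ⟨y, hy⟩ := OnePoint.ne_infty_iff_exists.1 (mem_finiteIndices.1 hi)
          rw [← hy, finitePart_coe]
        calc coulombCost k (fun i => finitePart (x (f i)))
            = ∑ i, ∑ j ∈ Finset.Ioi i, extKernel (x (f i)) (x (f j)) := by
              refine Finset.sum_congr rfl fun i _ => Finset.sum_congr rfl fun j _ => ?_
              rw [hx i, hx j, extKernel_coe]
          _ ≤ extCost N x :=
              sum_Ioi_comp_embedding_le (fun a b => extKernel (x a) (x b))
                (fun a b => extKernel_comm _ _) f

/-- The factor `k` cancels the normalization in `stratumMarginal`. Up to `1 / N`, both sides then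
give a Borel set `B` the expected number of finite points lying in `B`. -/
theorem sum_smul_stratumMarginal (P : Measure (Fin N → OnePoint (EuclideanSpace ℝ (Fin d)))) :
    ∑ k ∈ Finset.Icc 1 N, ((k : ℝ≥0∞) / (N : ℝ≥0∞)) • stratumMarginal P k =
      (N : ℝ≥0∞)⁻¹ • ∑ a : Fin N, (P.map fun x => x a).comap (↑) := by
  have hsmul : ∀ k ∈ Finset.Icc 1 N, ((k : ℝ≥0∞) / (N : ℝ≥0∞)) • stratumMarginal P k =
      (N : ℝ≥0∞)⁻¹ • ∑ i : Fin k, (stratum P k).map fun y => y i := by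
    intro k hk
    have hk0 : (k : ℝ≥0∞) ≠ 0 := by
      exact_mod_cast (by have := (Finset.mem_Icc.1 hk).1; omega : k ≠ 0)
    rw [stratumMarginal, smul_smul, div_eq_mul_inv, mul_comm (k : ℝ≥0∞), mul_assoc,
      ENNReal.mul_inv_cancel hk0 (ENNReal.natCast_ne_top k), mul_one]
  rw [Finset.sum_congr rfl hsmul, ← Finset.smul_sum]
  congr 1
  ext B hB
  have hind : Measurable (B.indicator (1 : EuclideanSpace ℝ (Fin d) → ℝ≥0∞)) :=
    measurable_one.indicator hB
  simp only [Measure.finsetSum_apply]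
  have h1 : ∀ k, ∑ i : Fin k, ((stratum P k).map fun y => y i) B =
      ∫⁻ y, ∑ i : Fin k, B.indicator 1 (y i) ∂(stratum P k) := by
    intro k
    rw [lintegral_finsetSum
      (f := fun i (y : Fin k → EuclideanSpace ℝ (Fin d)) => B.indicator 1 (y i)) _ fun i _ => hind.comp (measurable_pi_apply i)]
    refine Finset.sum_congr rfl fun i _ => ?_
    rw [← lintegral_indicator_one hB, lintegral_map hind (measurable_pi_apply i)]
  simp_rw [h1]
  rw [sum_lintegral_stratum P (g := fun k y => ∑ i : Fin k, B.indicator 1 (y i))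
    fun k => Finset.measurable_fun_sum _ fun i _ =>
    hind.comp (measurable_pi_apply i)]
  have hBim : MeasurableSet ((↑) '' B : Set (OnePoint (EuclideanSpace ℝ (Fin d)))) :=
    OnePoint.measurableEmbedding_coe.measurableSet_image.2 hB
  have hind' : Measurable (((↑) '' B : Set (OnePoint (EuclideanSpace ℝ (Fin d)))).indicator
      (1 : OnePoint (EuclideanSpace ℝ (Fin d)) → ℝ≥0∞)) := measurable_one.indicator hBim
  have h2 : ∀ a : Fin N, (P.map fun x => x a).comap (↑) B =
      ∫⁻ x, ((↑) '' B : Set (OnePoint (EuclideanSpace ℝ (Fin d)))).indicator 1 (x a) ∂P := by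
    intro a
    rw [OnePoint.measurableEmbedding_coe.comap_apply, ← lintegral_indicator_one hBim,
      lintegral_map hind' (measurable_pi_apply a)]
  simp_rw [h2]
  rw [← lintegral_finsetSum (f := fun (a : Fin N) (x : Fin N → OnePoint _) =>
    ((↑) '' B : Set (OnePoint (EuclideanSpace ℝ (Fin d)))).indicator 1 (x a)) _
    fun a _ => hind'.comp (measurable_pi_apply a)]
  refine lintegral_congr fun x => ?_
  rw [sum_Icc_sum_embeddingWeight_mul_sum (finiteIndices x)
    (fun a => B.indicator 1 (finitePart (x a)))]
  refine (Finset.sum_congr rfl fun a ha => ?_).trans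
    (Finset.sum_subset (Finset.subset_univ (finiteIndices x)) fun a _ ha => ?_)
  · obtain ⟨y, hy⟩ := OnePoint.ne_infty_iff_exists.1 (mem_finiteIndices.1 ha)
    rw [← hy, finitePart_coe]
    by_cases hyB : y ∈ B
    · simp [hyB]
    · simp [hyB]
  · rw [mem_finiteIndices, not_not] at ha
    simp [ha]

end Strata

/-! ### Compactness of the extended plans and passage to the limit. -/

section Compactness

variable {d N : ℕ}

/-- The extension by `0` at infinity of a function vanishing at infinity. -/
noncomputable def extendByZero (φ : C₀(EuclideanSpace ℝ (Fin d), ℝ)) :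
    C(OnePoint (EuclideanSpace ℝ (Fin d)), ℝ) :=
  OnePoint.continuousMapMk φ.toContinuousMap 0 (by
    rw [Filter.coclosedCompact_eq_cocompact]
    exact φ.zero_at_infty')

theorem extendByZero_coe (φ : C₀(EuclideanSpace ℝ (Fin d), ℝ)) (x : EuclideanSpace ℝ (Fin d)) :
    extendByZero φ (x : OnePoint (EuclideanSpace ℝ (Fin d))) = φ x := rfl

theorem extendByZero_infty (φ : C₀(EuclideanSpace ℝ (Fin d), ℝ)) :
    extendByZero φ OnePoint.infty = 0 := rfl

theorem integral_comap_coe (μ : Measure (OnePoint (EuclideanSpace ℝ (Fin d))))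
    (φ : C₀(EuclideanSpace ℝ (Fin d), ℝ)) :
    ∫ x, φ x ∂(μ.comap ((↑) : EuclideanSpace ℝ (Fin d) → OnePoint (EuclideanSpace ℝ (Fin d)))) =
      ∫ x, extendByZero φ x ∂μ := by
  have h := OnePoint.measurableEmbedding_coe.integral_map
    (μ := μ.comap ((↑) : EuclideanSpace ℝ (Fin d) → OnePoint (EuclideanSpace ℝ (Fin d))))
    (extendByZero φ)
  rw [OnePoint.measurableEmbedding_coe.map_comap] at h
  simp_rw [extendByZero_coe] at h
  rw [← h]
  refine setIntegral_eq_integral_of_forall_compl_eq_zero fun x hx => ?_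
  rw [OnePoint.notMem_range_coe_iff] at hx
  rw [hx, extendByZero_infty]

/-- The probabilities on configurations of `N` points, possibly at infinity, whose average
marginal restricts to `ρ` on `ℝ^d`. -/
def extPlans (N : ℕ) (ρ : Measure (EuclideanSpace ℝ (Fin d))) :
    Set (ProbabilityMeasure (Fin N → OnePoint (EuclideanSpace ℝ (Fin d)))) :=
  {P | ∀ φ : C₀(EuclideanSpace ℝ (Fin d), ℝ),
    (N : ℝ)⁻¹ * ∑ a, ∫ x, extendByZero φ (x a) ∂P.toMeasure = ∫ x, φ x ∂ρ}

theorem continuous_integral_extendByZero (φ : C₀(EuclideanSpace ℝ (Fin d), ℝ)) :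
    Continuous fun P : ProbabilityMeasure (Fin N → OnePoint (EuclideanSpace ℝ (Fin d))) =>
      (N : ℝ)⁻¹ * ∑ a, ∫ x, extendByZero φ (x a) ∂P.toMeasure := by
  refine continuous_const.mul (continuous_finsetSum _ fun a _ => ?_)
  exact ProbabilityMeasure.continuous_integral_boundedContinuousFunction
    (BoundedContinuousFunction.mkOfCompact ((extendByZero φ).comp
      ⟨fun x : Fin N → _ => x a, continuous_apply a⟩))

/-- Probabilities on a compact metrizable space form a compact space, and each test function,
extended continuously by `0`, imposes a closed condition. -/
theorem isCompact_extPlans (ρ : Measure (EuclideanSpace ℝ (Fin d))) :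
    IsCompact (extPlans N ρ) := by
  refine IsClosed.isCompact ?_
  have : extPlans N ρ = ⋂ φ : C₀(EuclideanSpace ℝ (Fin d), ℝ),
      {P | (N : ℝ)⁻¹ * ∑ a, ∫ x, extendByZero φ (x a) ∂P.toMeasure = ∫ x, φ x ∂ρ} := by
    ext P
    simp [extPlans]
  rw [this]
  exact isClosed_iInter fun φ =>
    isClosed_eq (continuous_integral_extendByZero φ) continuous_const

/-- Finite measures on `ℝ^d` are determined by the functions vanishing at infinity. -/
theorem ext_of_integral_zeroAtInfty {μ ν : Measure (EuclideanSpace ℝ (Fin d))}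
    [IsFiniteMeasure μ] [IsFiniteMeasure ν]
    (h : ∀ φ : C₀(EuclideanSpace ℝ (Fin d), ℝ), ∫ x, φ x ∂μ = ∫ x, φ x ∂ν) : μ = ν := by
  refine Measure.ext_of_integral_eq_on_compactlySupported fun f => ?_
  exact h ⟨f.toContinuousMap, f.hasCompactSupport.is_zero_at_infty⟩

theorem average_comap_eq_of_mem_extPlans (hN : 1 ≤ N) {ρ : Measure (EuclideanSpace ℝ (Fin d))}
    [IsFiniteMeasure ρ]
    {P : ProbabilityMeasure (Fin N → OnePoint (EuclideanSpace ℝ (Fin d)))}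
    (hP : P ∈ extPlans N ρ) :
    (N : ℝ≥0∞)⁻¹ • ∑ a : Fin N, (P.toMeasure.map fun x => x a).comap
      ((↑) : EuclideanSpace ℝ (Fin d) → OnePoint (EuclideanSpace ℝ (Fin d))) = ρ := by
  have hN0 : (N : ℝ≥0∞) ≠ 0 := by exact_mod_cast (by omega : N ≠ 0)
  have hfin : ∀ a : Fin N, IsFiniteMeasure ((P.toMeasure.map fun x => x a).comap
      ((↑) : EuclideanSpace ℝ (Fin d) → OnePoint (EuclideanSpace ℝ (Fin d)))) := fun a => ⟨by
    rw [OnePoint.measurableEmbedding_coe.comap_apply]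
    exact measure_lt_top _ _⟩
  have hfin' : IsFiniteMeasure ((N : ℝ≥0∞)⁻¹ • ∑ a : Fin N,
      (P.toMeasure.map fun x => x a).comap
      ((↑) : EuclideanSpace ℝ (Fin d) → OnePoint (EuclideanSpace ℝ (Fin d)))) :=
    Measure.smul_finite _ (ENNReal.inv_ne_top.2 hN0)
  refine ext_of_integral_zeroAtInfty fun φ => ?_
  rw [← hP φ, integral_smul_measure, integral_finsetSum_measure]
  · simp only [ENNReal.toReal_inv, ENNReal.toReal_natCast, smul_eq_mul]
    congr 1
    refine Finset.sum_congr rfl fun a _ => ?_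
    rw [integral_comap_coe, integral_map (measurable_pi_apply a).aemeasurable
      (extendByZero φ).continuous.measurable.aestronglyMeasurable]
  · exact fun a _ => φ.toBCF.integrable _

/-- A weak* convergent sequence of probabilities with cost frequently less than `L` has a limit
plan, possibly with points at infinity, of cost at most `L`. -/
theorem exists_extPlan_of_liminf_lt (hN : 1 ≤ N) {ρ : Measure (EuclideanSpace ℝ (Fin d))}
    {ρs : ℕ → Measure (EuclideanSpace ℝ (Fin d))} (hρs : WeakStarTendsto ρs ρ) {L : ℝ≥0∞}
    (hL : liminf (fun n => transportCost N (ρs n)) atTop < L) :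
    ∃ P ∈ extPlans N ρ, ∫⁻ x, extCost N x ∂P.toMeasure ≤ L := by
  have hfreq : ∃ᶠ n in atTop, transportCost N (ρs n) < L :=
    frequently_lt_of_liminf_lt (by isBoundedDefault) hL
  have hm : Measurable fun (x : Fin N → EuclideanSpace ℝ (Fin d)) (a : Fin N) =>
      (x a : OnePoint (EuclideanSpace ℝ (Fin d))) :=
    measurable_pi_lambda _ fun a =>
      OnePoint.continuous_coe.measurable.comp (measurable_pi_apply a)
  have hex : ∀ n, ∃ P : ProbabilityMeasure (Fin N → OnePoint (EuclideanSpace ℝ (Fin d))),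
      transportCost N (ρs n) < L → ∫⁻ x, extCost N x ∂P.toMeasure ≤ L ∧
        ∀ φ : C₀(EuclideanSpace ℝ (Fin d), ℝ),
          (N : ℝ)⁻¹ * ∑ a, ∫ x, extendByZero φ (x a) ∂P.toMeasure = ∫ x, φ x ∂(ρs n) := by
    intro n
    by_cases hn : transportCost N (ρs n) < L
    · have hn' := hn
      simp only [transportCost, iInf_lt_iff] at hn'
      obtain ⟨Q, ⟨hQprob, hQmarg⟩, hQ⟩ := hn'
      refine ⟨⟨Q.map _, Measure.isProbabilityMeasure_map hm.aemeasurable⟩, fun _ => ⟨?_, ?_⟩⟩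
      · rw [ProbabilityMeasure.coe_mk, lintegral_map (measurable_extCost N) hm]
        exact hQ.le
      · intro φ
        have ha : ∀ a : Fin N, ∫ x, extendByZero φ (x a) ∂(Q.map fun x a =>
            (x a : OnePoint (EuclideanSpace ℝ (Fin d)))) = ∫ x, φ x ∂(ρs n) := by
          intro a
          rw [integral_map hm.aemeasurable]
          · rw [← hQmarg a]
            exact (integral_map (φ := fun x : Fin N → EuclideanSpace ℝ (Fin d) => x a)
              (measurable_pi_apply _).aemeasurable
              φ.continuous.measurable.aestronglyMeasurable).symm
          · exact ((extendByZero φ).continuous.measurable.comp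
              (measurable_pi_apply a)).aestronglyMeasurable
        rw [ProbabilityMeasure.coe_mk]
        simp_rw [ha]
        have hN0 : (N : ℝ) ≠ 0 := by exact_mod_cast (by omega : N ≠ 0)
        simp [hN0]
    · exact ⟨⟨Measure.dirac fun _ => OnePoint.infty, inferInstance⟩, fun h => absurd h hn⟩
  choose Ps hPs using hex
  have hne : (atTop ⊓ 𝓟 {n | transportCost N (ρs n) < L} : Filter ℕ).NeBot :=
    frequently_iff_neBot.1 hfreq
  -- The ultrafilter replaces a subsequence: it is finer than `atTop`, concentrates on the indices
  -- of cost below `L`, and has a limit plan by compactness.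
  set U := Ultrafilter.of (atTop ⊓ 𝓟 {n | transportCost N (ρs n) < L}) with hU
  have hUle : (U : Filter ℕ) ≤ atTop ⊓ 𝓟 {n | transportCost N (ρs n) < L} := Ultrafilter.of_le _
  have hUtop : (U : Filter ℕ) ≤ atTop := hUle.trans inf_le_left
  have hUset : ∀ᶠ n in (U : Filter ℕ), transportCost N (ρs n) < L :=
    hUle.trans inf_le_right (mem_principal_self _)
  obtain ⟨P, -, hP⟩ := isCompact_univ.ultrafilter_le_nhds (U.map Ps) (by simp)
  have hPt : Tendsto Ps U (𝓝 P) := hP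
  refine ⟨P, fun φ => ?_, ?_⟩
  · have h1 := ((continuous_integral_extendByZero φ).tendsto P).comp hPt
    have h2 := (hρs φ).mono_left hUtop
    refine tendsto_nhds_unique h1 (h2.congr' ?_)
    filter_upwards [hUset] with n hn
    exact ((hPs n hn).2 φ).symm
  · have hclosed := (lowerSemicontinuous_lintegral
      (lowerSemicontinuous_extCost (d := d) N)).isClosed_preimage L
    exact hclosed.mem_of_tendsto hPt (hUset.mono fun n hn => (hPs n hn).1)

end Compactness

/-! ### The stratification formula and attainment. -/

theorem stratumMarginal_mem_stratifications {d N : ℕ} (hN : 1 ≤ N)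
    {ρ : Measure (EuclideanSpace ℝ (Fin d))} [IsFiniteMeasure ρ]
    {P : ProbabilityMeasure (Fin N → OnePoint (EuclideanSpace ℝ (Fin d)))}
    (hP : P ∈ extPlans N ρ) : stratumMarginal P.toMeasure ∈ stratifications N ρ := by
  have hmass := sum_stratumMarginal_univ_le P.toMeasure
  refine ⟨fun k hk => ?_, ?_, hmass⟩
  · exact (Finset.single_le_sum (f := fun k => stratumMarginal P.toMeasure k Set.univ)
      (fun _ _ => zero_le) hk).trans hmass
  · rw [sum_smul_stratumMarginal, average_comap_eq_of_mem_extPlans hN hP]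

theorem mainTheorem2 (d N : ℕ) (hd : 1 ≤ d) (hN : 1 ≤ N)
    (ρ : Measure (EuclideanSpace ℝ (Fin d))) (hρ : ρ Set.univ ≤ 1) :
    (relaxedCost N ρ =
        ⨅ ν ∈ stratifications N ρ, ∑ k ∈ Finset.Icc 1 N, partialCost k (ν k)) ∧
      (relaxedCost N ρ < ⊤ →
        ∃ ν₀ ∈ stratifications N ρ,
          ∑ k ∈ Finset.Icc 1 N, partialCost k (ν₀ k) =
            ⨅ ν ∈ stratifications N ρ, ∑ k ∈ Finset.Icc 1 N, partialCost k (ν k)) := by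
  have hfin : IsFiniteMeasure ρ := ⟨hρ.trans_lt ENNReal.one_lt_top⟩
  have hle : relaxedCost N ρ ≤
      ⨅ ν ∈ stratifications N ρ, ∑ k ∈ Finset.Icc 1 N, partialCost k (ν k) :=
    le_iInf₂ fun ν hν => relaxedCost_le_sum_partialCost hd hN hν
  rcases eq_or_ne (relaxedCost N ρ) ⊤ with htop | htop
  · refine ⟨le_antisymm hle (htop ▸ le_top), fun h => absurd htop h.ne⟩
  -- Finiteness of the relaxed cost gives a sequence with `liminf` below `⊤`, hence a limit plan.
  have hne : (extPlans N ρ).Nonempty := by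
    have hlt := lt_top_iff_ne_top.2 htop
    simp only [relaxedCost, iInf_lt_iff] at hlt
    obtain ⟨ρs, hρs, hlt⟩ := hlt
    obtain ⟨P, hP, -⟩ := exists_extPlan_of_liminf_lt hN hρs.2 hlt
    exact ⟨P, hP⟩
  obtain ⟨P, hP, hmin⟩ := ((lowerSemicontinuous_lintegral
    (lowerSemicontinuous_extCost (d := d) N)).lowerSemicontinuousOn _).exists_isMinOn hne
      (isCompact_extPlans ρ)
  -- Every competing sequence has a limit plan in `extPlans`, which costs at least as much as the
  -- minimizer `P`.
  have hPle : ∫⁻ x, extCost N x ∂P.toMeasure ≤ relaxedCost N ρ := by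
    refine le_iInf₂ fun ρs hρs => le_of_forall_gt fun L hL => ?_
    obtain ⟨L', hL', hL'L⟩ := exists_between hL
    obtain ⟨P', hP', hP'L⟩ := exists_extPlan_of_liminf_lt hN hρs.2 hL'
    exact ((hmin hP').trans hP'L).trans_lt hL'L
  have hmem := stratumMarginal_mem_stratifications hN hP
  have hcost : ∑ k ∈ Finset.Icc 1 N, partialCost k (stratumMarginal P.toMeasure k) ≤
      relaxedCost N ρ := (sum_partialCost_stratumMarginal_le P.toMeasure).trans hPle
  have hinf : ⨅ ν ∈ stratifications N ρ, ∑ k ∈ Finset.Icc 1 N, partialCost k (ν k) ≤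
      ∑ k ∈ Finset.Icc 1 N, partialCost k (stratumMarginal P.toMeasure k) :=
    iInf₂_le _ hmem
  exact ⟨le_antisymm hle (hinf.trans hcost),
    fun _ => ⟨_, hmem, le_antisymm (hcost.trans hle) hinf⟩⟩
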